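/- Let $d\ge 2$ and $[d]=\{1,\dots,d\}$. A (finite, unlabeled) $d$-type plane forest is a finite ordered sequence of finite rooted plane trees whose vertices carry types in $[d]$, such that the types of the children of each vertex, read from left to right, are nondecreasing; the sequence of the types of the roots of its successive trees is its root type sequence. A vertex has indegree type ${\rm u}=(u_1,\dots,u_d)$ if, for each $j\in[d]$, it has exactly $u_j$ children of type $j$. Let $r_i\ge 0$, $n_i\ge 0$ and $k_{ij}$ ($i,j\in[d]$) be integers such that $r_1+\dots+r_d\ge 1$, $k_{ij}\ge 0$ for $i\ne j$, $-k_{jj}=r_j+\sum_{i\ne j}k_{ij}$ for all $j$, and $n_i\ge -k_{ii}>0$ for all $i$. Put $k'_{ij}=k_{ij}$ for $i\neq j$ and $k'_{ii}=n_i+k_{ii}$. Let ${\rm U}=\prod_{i=1}^d\{0,1,\dots,n_i\}$ and let ${\rm N}=(N_{i,{\rm u}})_{i\in[d],{\rm u}\in{\rm U}}$ be nonnegative integers such that $n_i=\sum_{{\rm u}\in{\rm U}}N_{i,{\rm u}}$ and $k'_{ij}=\sum_{{\rm u}\in{\rm U}}u_jN_{i,{\rm u}}$ for all $i,j\in[d]$.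 Let $\mathcal F_d^{k_{ij},{\rm n}}({\rm N})$ be the set of $d$-type plane forests with $n_i$ vertices of type $i$ and $r_i$ roots of type $i$ for all $i$, with $k_{ij}$ vertices of type $j$ whose parent has type $i$ for all $i\ne j$, and with $N_{i,{\rm u}}$ vertices of type $i$ and indegree type ${\rm u}$ for all $i\in[d]$, ${\rm u}\in{\rm U}$. Then for every sequence ${\rm c}$ of elements of $[d]$ in which each $i\in[d]$ occurs exactly $r_i$ times (for instance, the nondecreasing one), the set of forests in $\mathcal F_d^{k_{ij},{\rm n}}({\rm N})$ with root type sequence ${\rm c}$ is finite, and its cardinality is $$\frac{\prod_{j=1}^d(n_j-1)!\;\det\big((-k_{ij})_{i,j\in[d]}\big)}{\prod_{i\in[d],\,{\rm u}\in{\rm U}}N_{i,{\rm u}}!}\,.$$ -/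

import Mathlib

/-- Finite ordered (plane) forests, up to isomorphism, whose vertices carry a type in `Fin d`.
A forest is either empty, or it consists of a first tree followed by the forest `rest` of the
remaining trees; the first tree is given by the type of its root and by the forest `children`
of the subtrees hanging from that root, read from left to right. -/
inductive PlaneForest (d : ℕ) : Type
  | nil : PlaneForest d
  | cons (rootType : Fin d) (children rest : PlaneForest d) : PlaneForest d

namespace PlaneForest

variable {d : ℕ}

/-- The root type sequence: the types of the roots of the successive trees. -/
def roots : PlaneForest d → List (Fin d)
  | nil => []
  | cons a _ rest => a :: rest.roots

/-- The list with one entry for each vertex: the pair formed by the type of the vertex and its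
indegree type, that is, the function giving for each `j` its number of children of type `j`. -/
def vertices : PlaneForest d → List (Fin d × (Fin d → ℕ))
  | nil => []
  | cons a children rest =>
      (a, fun j => children.roots.count j) :: (children.vertices ++ rest.vertices)

/-- The list with one entry for each non-root vertex: the pair
`(type of its parent, type of the vertex)`. -/
def edges : PlaneForest d → List (Fin d × Fin d)
  | nil => []
  | cons a children rest =>
      children.roots.map (fun b => (a, b)) ++ (children.edges ++ rest.edges)

/-- For every vertex, the types of its children, read from left to right, are nondecreasing. -/
def SiblingsSorted : PlaneForest d → Prop
  | nil => True
  | cons _ children rest =>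
      children.roots.Pairwise (· ≤ ·) ∧ children.SiblingsSorted ∧ rest.SiblingsSorted

end PlaneForest

/-- The set of (finite, unlabeled) `d`-type forests. -/
def dTypeForests (d : ℕ) : Set (PlaneForest d) :=
  {f | f.SiblingsSorted}

/-- The `d`-type forests with `n i` vertices of type `i`, with `r i` roots of type `i`, and, for
`i ≠ j`, with `k i j` vertices of type `j` whose parent has type `i`. -/
def forestsWithEdges {d : ℕ} (r n : Fin d → ℕ) (k : Matrix (Fin d) (Fin d) ℤ) :
    Set (PlaneForest d) :=
  {f | f ∈ dTypeForests d ∧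
    (∀ i, (f.vertices.map Prod.fst).count i = n i) ∧
    (∀ i, f.roots.count i = r i) ∧
    (∀ i j, i ≠ j → (f.edges.count (i, j) : ℤ) = k i j)}

/-- The forests of `forestsWithEdges r n k` having `N i u` vertices of type `i` and indegree
type `u`, for all `i` and all `u` in the box `∏ j, {0, …, n j}`. -/
def forestsWithIndegrees {d : ℕ} (r n : Fin d → ℕ) (k : Matrix (Fin d) (Fin d) ℤ)
    (N : Fin d → (Fin d → ℕ) → ℕ) : Set (PlaneForest d) :=
  {f | f ∈ forestsWithEdges r n k ∧
    ∀ i, ∀ u ∈ Finset.Iic n, f.vertices.count (i, u) = N i u}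

/-- The numbers `k'`: `k' i j = k i j` for `i ≠ j` and `k' i i = n i + k i i`. -/
def kPrime {d : ℕ} (n : Fin d → ℕ) (k : Matrix (Fin d) (Fin d) ℤ) (i j : Fin d) : ℤ :=
  if i = j then (n i : ℤ) + k i i else k i j

/-!
A forest with sorted siblings, root type sequence `c` and multiset of vertices `M` (each vertex
being recorded by its type and indegree type) is counted by a recursion on the number of vertices. If `c`
begins with the type `a` and the first root has indegree type `u`, then deleting that root and
letting its subtrees take its place gives a forest whose root type sequence is the sorted list of
content `u` followed by the tail of `c`, and whose multiset of vertices is `M` without `(a, u)`.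
Nothing is lost: `u` says how many of the first trees have to be put back under the deleted root
(`bijOn_deleteFirstRoot`).

Let `L(M)` be the matrix with entries `δ i j * n i - k' i j`, where `M` has `n i` vertices of type
`i`, which have `k' i j` children of type `j` altogether; row `a` of `L(M)` is the sum over the
vertices `(a, u)` in `M` of `e_a - u`, where `e_a` is the basis vector. The claim is that the number
of forests, multiplied by the factorials of the multiplicities in `M`, is
`∏ j, (n j - 1)! * det L(M)`. This satisfies the recursion because of the linearity of `det` in row
`a`: removing `(a, u)` subtracts `e_a - u` from row `a`, and summing the resulting determinants over
the `n a` vertices of type `a` gives `n a * det L(M) - det L(M)`, while `(n a - 1)!` becomes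
`(n a - 2)!` (`sum_det_laplacian_erase`). When the last vertex of type `a` is removed, the type
drops out of the matrix; a root of that type is then the only vertex of the type, column `a` of
`L(M)` is `e_a`, and the determinant does not change (`det_laplacian_of_cons`). The recursion ends
with an empty `c`, where `det L(M)` is `1` if `M` is empty and `0` otherwise, since the columns of
`L(M)`, restricted to the types that occur, then sum to zero (`det_laplacian_eq_zero`). This proves
`finite_and_ncard_withRootsAndVertices`, of which the theorem is the case where `M` consists of
`N i u` copies of `(i, u)` and `L(M) = -k`.
-/

/-! ### Concatenation of forests -/

namespace PlaneForest

variable {d : ℕ}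

/-- Concatenation of two forests, as sequences of trees. -/
def append : PlaneForest d → PlaneForest d → PlaneForest d
  | nil, g => g
  | cons a children rest, g => cons a children (rest.append g)

@[simp]
lemma roots_append (f g : PlaneForest d) : (f.append g).roots = f.roots ++ g.roots := by
  induction f with
  | nil => rfl
  | cons a ch rest _ ih => simp [append, roots, ih]

@[simp]
lemma vertices_append (f g : PlaneForest d) :
    (f.append g).vertices = f.vertices ++ g.vertices := by
  induction f with
  | nil => rfl
  | cons a ch rest _ ih => simp [append, vertices, ih]

@[simp]
lemma siblingsSorted_append (f g : PlaneForest d) :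
    (f.append g).SiblingsSorted ↔ f.SiblingsSorted ∧ g.SiblingsSorted := by
  induction f with
  | nil => simp [append, SiblingsSorted]
  | cons a ch rest _ ih => simp [append, SiblingsSorted, ih, and_assoc]

lemma append_inj {f f' g g' : PlaneForest d} (h : f.roots = f'.roots)
    (hfg : f.append g = f'.append g') : f = f' ∧ g = g' := by
  induction f generalizing f' with
  | nil => cases f' with
    | nil => exact ⟨rfl, hfg⟩
    | cons => simp [roots] at h
  | cons a ch rest _ ih => cases f' with
    | nil => simp [roots] at h
    | cons a' ch' rest' =>
      simp only [roots, List.cons.injEq] at h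
      simp only [append, cons.injEq] at hfg
      obtain ⟨h₁, h₂⟩ := ih h.2 hfg.2.2
      simp [hfg.1, hfg.2.1, h₁, h₂]

lemma exists_eq_append_of_roots_eq_append {f : PlaneForest d} {l₁ l₂ : List (Fin d)}
    (h : f.roots = l₁ ++ l₂) :
    ∃ f₁ f₂ : PlaneForest d, f = f₁.append f₂ ∧ f₁.roots = l₁ ∧ f₂.roots = l₂ := by
  induction l₁ generalizing f with
  | nil => exact ⟨nil, f, rfl, rfl, h⟩
  | cons a l ih =>
    cases f with
    | nil => simp [roots] at h
    | cons b ch rest =>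
      simp only [roots, List.cons_append, List.cons.injEq] at h
      obtain ⟨f₁, f₂, rfl, h₁, h₂⟩ := ih h.2
      exact ⟨cons b ch f₁, f₂, rfl, by simp [roots, h.1, h₁], h₂⟩

/-- The nondecreasing list in which each `j` occurs `u j` times. -/
noncomputable def sortedList (u : Fin d → ℕ) : List (Fin d) :=
  (Finsupp.toMultiset (Finsupp.equivFunOnFinite.symm u)).sort (· ≤ ·)

@[simp]
lemma count_sortedList (u : Fin d → ℕ) (j : Fin d) : (sortedList u).count j = u j := by
  rw [sortedList, ← Multiset.coe_count, Multiset.sort_eq, Finsupp.count_toMultiset]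
  rfl

lemma pairwise_sortedList (u : Fin d → ℕ) : (sortedList u).Pairwise (· ≤ ·) :=
  Multiset.pairwise_sort _ _

lemma eq_sortedList {l : List (Fin d)} (hl : l.Pairwise (· ≤ ·)) :
    l = sortedList fun j => l.count j :=
  List.Perm.eq_of_pairwise' hl (pairwise_sortedList _) (List.perm_iff_count.2 fun j => by simp)

/-! ### Deletion of the first root -/

/-- The forests with sorted siblings whose root type sequence is `c` and whose vertices, recorded
by type and indegree type, form the multiset `M`. -/
def withRootsAndVertices (c : List (Fin d)) (M : Multiset (Fin d × (Fin d → ℕ))) :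
    Set (PlaneForest d) :=
  {f | f.SiblingsSorted ∧ f.roots = c ∧ (f.vertices : Multiset _) = M}

lemma withRootsAndVertices_nil_zero :
    withRootsAndVertices ([] : List (Fin d)) 0 = {nil} := by
  ext f
  cases f <;> simp [withRootsAndVertices, roots, vertices, SiblingsSorted]

lemma withRootsAndVertices_nil_of_ne_zero {M : Multiset (Fin d × (Fin d → ℕ))} (hM : M ≠ 0) :
    withRootsAndVertices ([] : List (Fin d)) M = ∅ := by
  ext f
  cases f <;> simp [withRootsAndVertices, roots, vertices, SiblingsSorted, hM.symm]

/-- Deletion of the first root: the trees hanging from it take the place of the first tree. -/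
def deleteFirstRoot : PlaneForest d → PlaneForest d
  | nil => nil
  | cons _ children rest => children.append rest

/-- Once the type and the indegree type of the first root are known, deleting that root loses no
information: sortedness determines the list of its children, hence where to cut the remaining
forest. -/
lemma bijOn_deleteFirstRoot (c : List (Fin d)) {M : Multiset (Fin d × (Fin d → ℕ))}
    {p : Fin d × (Fin d → ℕ)} (hp : p ∈ M) :
    Set.BijOn deleteFirstRoot
      {f ∈ withRootsAndVertices (p.1 :: c) M | f.vertices.head? = some p}
      (withRootsAndVertices (sortedList p.2 ++ c) (M.erase p)) := by
  obtain ⟨a, u⟩ := p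
  -- A forest in the source is `cons a ch rest` with `ch.roots = sortedList u`.
  have key : ∀ f ∈ {f ∈ withRootsAndVertices (a :: c) M | f.vertices.head? = some (a, u)},
      ∃ ch rest, f = cons a ch rest ∧ ch.roots = sortedList u := by
    rintro f ⟨⟨hs, hr, -⟩, hh⟩
    cases f with
    | nil => simp [roots] at hr
    | cons b ch rest =>
      simp only [vertices, List.head?_cons, Option.some.injEq, Prod.mk.injEq] at hh
      refine ⟨ch, rest, by rw [hh.1], ?_⟩
      rw [eq_sortedList hs.1, hh.2]
  refine ⟨fun f hf => ?_, fun f hf g hg hfg => ?_, fun g hg => ?_⟩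
  · obtain ⟨ch, rest, rfl, hch⟩ := key f hf
    obtain ⟨⟨hs, hr, hv⟩, hh⟩ := hf
    simp only [SiblingsSorted, roots, vertices, List.cons.injEq, List.head?_cons,
      Option.some.injEq] at hs hr hv hh
    refine ⟨(siblingsSorted_append _ _).2 hs.2, by simp [deleteFirstRoot, hch, hr.2], ?_⟩
    rw [← hv, hh, ← Multiset.cons_coe, Multiset.erase_cons_head]
    simp [deleteFirstRoot]
  · obtain ⟨ch, rest, rfl, hch⟩ := key f hf
    obtain ⟨ch', rest', rfl, hch'⟩ := key g hg
    obtain ⟨rfl, rfl⟩ := append_inj (hch.trans hch'.symm) hfg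
    rfl
  · obtain ⟨hs, hr, hv⟩ := hg
    obtain ⟨ch, rest, rfl, h₁, h₂⟩ := exists_eq_append_of_roots_eq_append hr
    have hu : (fun j => ch.roots.count j) = u := by
      funext j
      rw [h₁, count_sortedList]
    rw [siblingsSorted_append] at hs
    refine ⟨cons a ch rest, ⟨⟨⟨?_, hs⟩, by simp [roots, h₂], ?_⟩, by simp [vertices, hu]⟩, rfl⟩
    · rw [h₁]
      exact pairwise_sortedList u
    · rw [vertices, hu, ← Multiset.cons_coe, ← vertices_append, hv, Multiset.cons_erase hp]

/-- The recursion obtained by splitting the forests according to the indegree type of their first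
root. -/
lemma finite_and_ncard_withRootsAndVertices_cons (a : Fin d) (c : List (Fin d))
    (M : Multiset (Fin d × (Fin d → ℕ)))
    (hfin : ∀ p ∈ M, p.1 = a →
      (withRootsAndVertices (sortedList p.2 ++ c) (M.erase p)).Finite) :
    (withRootsAndVertices (a :: c) M).Finite ∧
      (withRootsAndVertices (a :: c) M).ncard =
        ∑ p ∈ M.toFinset with p.1 = a,
          (withRootsAndVertices (sortedList p.2 ++ c) (M.erase p)).ncard := by
  have hhead : ∀ f ∈ withRootsAndVertices (a :: c) M,
      ∃ p ∈ M, p.1 = a ∧ f.vertices.head? = some p := by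
    rintro f ⟨-, hr, hv⟩
    cases f with
    | nil => simp [roots] at hr
    | cons b ch rest =>
      refine ⟨(b, fun j => ch.roots.count j), ?_, (List.cons.inj hr).1, rfl⟩
      rw [← hv, vertices]
      simp
  have hF : (withRootsAndVertices (a :: c) M).Finite := by
    refine Set.Finite.subset (Set.Finite.biUnion
      (M.toFinset.filter (·.1 = a)).finite_toSet (t := fun p =>
        {f ∈ withRootsAndVertices (p.1 :: c) M | f.vertices.head? = some p}) ?_) ?_
    · intro p hp
      obtain ⟨hpM, hpa⟩ : p ∈ M ∧ p.1 = a := by simpa using hp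
      exact (bijOn_deleteFirstRoot c hpM).finite_iff_finite.2 (hfin p hpM hpa)
    · intro f hf
      obtain ⟨p, hpM, rfl, hp⟩ := hhead f hf
      simp only [Set.mem_iUnion]
      exact ⟨p, by simpa using hpM, hf, hp⟩
  refine ⟨hF, ?_⟩
  classical
  rw [Set.ncard_eq_toFinset_card _ hF, Finset.card_eq_sum_card_fiberwise
    (f := fun f => f.vertices.head?)
    (t := (M.toFinset.filter (·.1 = a)).map ⟨some, Option.some_injective _⟩),
    Finset.sum_map]
  · refine Finset.sum_congr rfl fun p hp => ?_
    obtain ⟨hpM, rfl⟩ : p ∈ M ∧ p.1 = a := by simpa using hp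
    rw [← (bijOn_deleteFirstRoot c hpM).image_eq,
      (bijOn_deleteFirstRoot c hpM).injOn.ncard_image, ← Set.ncard_coe_finset]
    congr 1
    ext f
    simp
  · intro f hf
    obtain ⟨p, hpM, hpa, hp⟩ := hhead f (by simpa using hf)
    simp only [Finset.coe_map, Set.mem_image]
    exact ⟨p, by simpa using ⟨hpM, hpa⟩, hp.symm⟩

end PlaneForest

/-! ### The Laplacian of a multiset of vertices -/

namespace PlaneForest

variable {d : ℕ}

/-- The number of vertices of type `i` in the multiset `M`. -/
def typeCount (M : Multiset (Fin d × (Fin d → ℕ))) (i : Fin d) : ℕ :=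
  M.countP (·.1 = i)

/-- The number of children of type `j` of the vertices of type `i` in the multiset `M`. -/
def childCount (M : Multiset (Fin d × (Fin d → ℕ))) (i j : Fin d) : ℕ :=
  ((M.filter (·.1 = i)).map (·.2 j)).sum

/-- The matrix with entries `δ i j * typeCount M i - childCount M i j`, except that a diagonal
entry `1` is put in for every type without vertices; its determinant is thus the one of the
submatrix indexed by the types that do occur. -/
def laplacian (M : Multiset (Fin d × (Fin d → ℕ))) : Matrix (Fin d) (Fin d) ℤ :=
  Matrix.diagonal (fun i => ((max (typeCount M i) 1 : ℕ) : ℤ)) -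
    Matrix.of fun i j => (childCount M i j : ℤ)

lemma laplacian_apply (M : Multiset (Fin d × (Fin d → ℕ))) (i j : Fin d) :
    laplacian M i j = (if i = j then ((max (typeCount M i) 1 : ℕ) : ℤ) else 0) -
      childCount M i j := by
  simp [laplacian, Matrix.diagonal_apply]

lemma typeCount_cons (p : Fin d × (Fin d → ℕ)) (M : Multiset (Fin d × (Fin d → ℕ)))
    (i : Fin d) : typeCount (p ::ₘ M) i = typeCount M i + if p.1 = i then 1 else 0 := by
  simp [typeCount, Multiset.countP_cons]

lemma childCount_cons (p : Fin d × (Fin d → ℕ)) (M : Multiset (Fin d × (Fin d → ℕ)))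
    (i j : Fin d) :
    childCount (p ::ₘ M) i j = childCount M i j + if p.1 = i then p.2 j else 0 := by
  by_cases h : p.1 = i <;> simp [childCount, h, add_comm]

lemma childCount_eq_zero_of_typeCount_eq_zero {M : Multiset (Fin d × (Fin d → ℕ))} {i : Fin d}
    (h : typeCount M i = 0) (j : Fin d) : childCount M i j = 0 := by
  rw [typeCount, Multiset.countP_eq_card_filter, Multiset.card_eq_zero] at h
  simp [childCount, h]

/-- The row that a vertex of type `p.1` and indegree type `p.2` contributes to the Laplacian. -/
def rowOf (p : Fin d × (Fin d → ℕ)) : Fin d → ℤ :=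
  fun j => (if p.1 = j then 1 else 0) - (p.2 j : ℤ)

lemma sum_rowOf (M : Multiset (Fin d × (Fin d → ℕ))) {a : Fin d} (ha : typeCount M a ≠ 0) :
    ((M.filter (·.1 = a)).map rowOf).sum = laplacian M a := by
  have key : ∀ M : Multiset (Fin d × (Fin d → ℕ)), ∀ j,
      ((M.filter (·.1 = a)).map rowOf).sum j =
        (if a = j then (typeCount M a : ℤ) else 0) - childCount M a j := by
    intro M j
    induction M using Multiset.induction_on with
    | empty => simp [typeCount, childCount]
    | cons p M ih =>
      by_cases h : p.1 = a
      · rw [Multiset.filter_cons_of_pos (p := fun x : Fin d × (Fin d → ℕ) => x.1 = a) _ h,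
          Multiset.map_cons, Multiset.sum_cons, Pi.add_apply, ih, typeCount_cons,
          childCount_cons, rowOf, h]
        simp only [if_true]
        split_ifs <;> push_cast <;> ring
      · rw [Multiset.filter_cons_of_neg (p := fun x : Fin d × (Fin d → ℕ) => x.1 = a) _ h,
          ih, typeCount_cons, childCount_cons]
        simp [h]
  funext j
  rw [key, laplacian_apply, max_eq_left (Nat.one_le_iff_ne_zero.2 ha)]

/-- Removing a vertex of type `a`, when others remain, subtracts its row from row `a`. -/
lemma laplacian_of_cons {p : Fin d × (Fin d → ℕ)} {M : Multiset (Fin d × (Fin d → ℕ))}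
    (h : typeCount M p.1 ≠ 0) :
    laplacian M = (laplacian (p ::ₘ M)).updateRow p.1 (laplacian (p ::ₘ M) p.1 - rowOf p) := by
  ext i j
  rw [Matrix.updateRow_apply]
  split_ifs with hi
  · subst hi
    have h' : 1 ≤ typeCount M p.1 := Nat.one_le_iff_ne_zero.2 h
    rw [Pi.sub_apply, laplacian_apply, laplacian_apply, typeCount_cons, childCount_cons, rowOf]
    simp only [if_true, max_eq_left h', max_eq_left (Nat.le_succ_of_le h')]
    split_ifs <;> push_cast <;> ring
  · rw [laplacian_apply, laplacian_apply, typeCount_cons, childCount_cons]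
    simp [Ne.symm hi]

lemma det_updateRow_multisetSum (A : Matrix (Fin d) (Fin d) ℤ) (a : Fin d)
    (s : Multiset (Fin d → ℤ)) :
    (A.updateRow a s.sum).det = (s.map fun v => (A.updateRow a v).det).sum :=
  map_multiset_sum (Matrix.detRowAlternating.toMultilinearMap.toLinearMap A a) s

lemma det_updateRow_sub (A : Matrix (Fin d) (Fin d) ℤ) (a : Fin d) (v w : Fin d → ℤ) :
    (A.updateRow a (v - w)).det = (A.updateRow a v).det - (A.updateRow a w).det :=
  map_sub (Matrix.detRowAlternating.toMultilinearMap.toLinearMap A a) v w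

/-- By linearity of the determinant in row `a`, which is the sum of the rows contributed by the
vertices of type `a`. -/
lemma sum_det_laplacian_erase {M : Multiset (Fin d × (Fin d → ℕ))} {a : Fin d}
    (ha : 2 ≤ typeCount M a) :
    ((M.filter (·.1 = a)).map fun p => (laplacian (M.erase p)).det).sum =
      ((typeCount M a - 1 : ℕ) : ℤ) * (laplacian M).det := by
  have h₁ : ∀ p ∈ M.filter (·.1 = a), (laplacian (M.erase p)).det =
      (laplacian M).det - ((laplacian M).updateRow a (rowOf p)).det := by
    intro p hp
    obtain ⟨hpM, rfl⟩ := Multiset.mem_filter.1 hp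
    obtain ⟨M, rfl⟩ := Multiset.exists_cons_of_mem hpM
    rw [Multiset.erase_cons_head, laplacian_of_cons (p := p) (M := M), det_updateRow_sub,
      Matrix.updateRow_eq_self]
    rw [typeCount_cons] at ha
    simp only [if_true] at ha
    omega
  rw [Multiset.map_congr rfl h₁, Multiset.sum_map_sub]
  have h₂ := det_updateRow_multisetSum (laplacian M) a ((M.filter (·.1 = a)).map rowOf)
  rw [sum_rowOf M (by omega), Matrix.updateRow_eq_self, Multiset.map_map] at h₂
  simp only [Function.comp_def] at h₂
  rw [← h₂, Multiset.map_const', Multiset.sum_replicate, nsmul_eq_mul,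
    ← Multiset.countP_eq_card_filter, ← typeCount, Nat.cast_sub (by omega)]
  push_cast
  ring

/-- If a forest has a root of type `a` and no other vertex of type `a`, then nothing is a parent of
a vertex of type `a`, so that column `a` of the Laplacian is a basis vector and row `a` does not
matter outside the diagonal. -/
lemma det_laplacian_of_cons {p : Fin d × (Fin d → ℕ)} {M : Multiset (Fin d × (Fin d → ℕ))}
    (h : typeCount M p.1 = 0) (hcol : ∀ i, childCount (p ::ₘ M) i p.1 = 0) :
    (laplacian M).det = (laplacian (p ::ₘ M)).det := by
  have hu : p.2 p.1 = 0 := by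
    have := hcol p.1
    rw [childCount_cons] at this
    simp only [if_true] at this
    omega
  have hL : laplacian (p ::ₘ M) = (laplacian M).updateRow p.1
      (laplacian M p.1 - fun j => (p.2 j : ℤ)) := by
    ext i j
    rw [Matrix.updateRow_apply]
    split_ifs with hi
    · subst hi
      rw [Pi.sub_apply, laplacian_apply, laplacian_apply, typeCount_cons, childCount_cons, h]
      simp only [if_true]
      split_ifs <;> push_cast <;> simp <;> ring
    · rw [laplacian_apply, laplacian_apply, typeCount_cons, childCount_cons]
      simp [Ne.symm hi]
  rw [hL, det_updateRow_sub, Matrix.updateRow_eq_self,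
    Matrix.det_eq_zero_of_column_eq_zero (A := (laplacian M).updateRow p.1 _) p.1, sub_zero]
  intro i
  rw [Matrix.updateRow_apply]
  split_ifs with hi
  · simp [hu]
  · have := hcol i
    rw [childCount_cons] at this
    rw [laplacian_apply, if_neg hi]
    simp only [zero_sub, neg_eq_zero, Nat.cast_eq_zero]
    omega

/-- Without roots, the indicator of the types that occur is in the left kernel of the Laplacian. -/
lemma det_laplacian_eq_zero {M : Multiset (Fin d × (Fin d → ℕ))} (hM : M ≠ 0)
    (h : ∀ j, ∑ i, childCount M i j = typeCount M j) : (laplacian M).det = 0 := by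
  rw [← Matrix.exists_vecMul_eq_zero_iff]
  refine ⟨fun i => if typeCount M i = 0 then 0 else 1, fun h0 => ?_, ?_⟩
  · obtain ⟨p, hp⟩ := Multiset.exists_mem_of_ne_zero hM
    have : 0 < typeCount M p.1 := Multiset.countP_pos.2 ⟨p, hp, rfl⟩
    have := congrFun h0 p.1
    simp only [Pi.zero_apply, ite_eq_left_iff, one_ne_zero, imp_false, not_not] at this
    omega
  · funext j
    have hterm : ∀ i, (if typeCount M i = 0 then (0 : ℤ) else 1) * laplacian M i j =
        (if i = j then (typeCount M i : ℤ) else 0) - childCount M i j := by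
      intro i
      rw [laplacian_apply]
      by_cases hi : typeCount M i = 0
      · simp [hi, childCount_eq_zero_of_typeCount_eq_zero hi]
      · rw [if_neg hi, one_mul, max_eq_left (Nat.one_le_iff_ne_zero.2 hi)]
    simp only [Matrix.vecMul, dotProduct, hterm, Finset.sum_sub_distrib, Pi.zero_apply]
    rw [Finset.sum_ite_eq' Finset.univ j, if_pos (Finset.mem_univ j), ← Nat.cast_sum, h, sub_self]

/-- The product of the factorials of the multiplicities of the elements of `M`. -/
def multiplicityFactorial (M : Multiset (Fin d × (Fin d → ℕ))) : ℕ :=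
  ∏ p ∈ M.toFinset, (M.count p).factorial

lemma multiplicityFactorial_cons (p : Fin d × (Fin d → ℕ))
    (M : Multiset (Fin d × (Fin d → ℕ))) :
    multiplicityFactorial (p ::ₘ M) = (p ::ₘ M).count p * multiplicityFactorial M := by
  have h₁ : multiplicityFactorial M =
      ∏ q ∈ (p ::ₘ M).toFinset, (M.count q).factorial := by
    refine Finset.prod_subset (by simp) fun q _ hq => ?_
    rw [Multiset.count_eq_zero_of_notMem (by simpa using hq), Nat.factorial_zero]
  have hp : p ∈ (p ::ₘ M).toFinset := by simp
  rw [h₁, multiplicityFactorial, ← Finset.mul_prod_erase _ _ hp, ← Finset.mul_prod_erase _ _ hp,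
    Multiset.count_cons_self, Nat.factorial_succ, mul_assoc]
  congr 2
  refine Finset.prod_congr rfl fun q hq => ?_
  rw [Multiset.count_cons_of_ne (Finset.ne_of_mem_erase hq)]

lemma sum_toFinset_filter_mul (M : Multiset (Fin d × (Fin d → ℕ))) (a : Fin d)
    (g : Fin d × (Fin d → ℕ) → ℤ) :
    ∑ p ∈ M.toFinset with p.1 = a, (M.count p : ℤ) * g p =
      ((M.filter (·.1 = a)).map g).sum := by
  rw [Finset.sum_multiset_map_count, Multiset.toFinset_filter]
  refine Finset.sum_congr rfl fun p hp => ?_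
  rw [Multiset.count_filter_of_pos (p := fun x : Fin d × (Fin d → ℕ) => x.1 = a)
    (Finset.mem_filter.1 hp).2, nsmul_eq_mul]

/-! ### Enumeration by roots and vertices -/

/-- The enumeration of forests by their root type sequence and their vertices. The hypothesis says
that every vertex of `M` is either a root or a child. For a type without vertices the truncated
subtraction gives the factor `0! = 1`. -/
theorem finite_and_ncard_withRootsAndVertices (M : Multiset (Fin d × (Fin d → ℕ)))
    (c : List (Fin d)) (h : ∀ j, c.count j + ∑ i, childCount M i j = typeCount M j) :
    (withRootsAndVertices c M).Finite ∧
      ((withRootsAndVertices c M).ncard : ℤ) * multiplicityFactorial M =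
        (∏ j, ((typeCount M j - 1).factorial : ℤ)) * (laplacian M).det := by
  induction hm : M.card generalizing M c with
  | zero =>
    obtain rfl := Multiset.card_eq_zero.1 hm
    have hc : c = [] := List.eq_nil_iff_forall_not_mem.2 fun j hj => by
      have := h j
      have := List.count_pos_iff.2 hj
      simp only [typeCount, Multiset.countP_zero] at *
      omega
    subst hc
    rw [withRootsAndVertices_nil_zero]
    have hL : laplacian (0 : Multiset (Fin d × (Fin d → ℕ))) = 1 := by
      ext i j
      simp [laplacian_apply, typeCount, childCount, Matrix.one_apply]
    simp [multiplicityFactorial, typeCount, hL]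
  | succ m ih =>
    have hM : M ≠ 0 := by
      rintro rfl
      simp at hm
    cases c with
    | nil =>
      rw [withRootsAndVertices_nil_of_ne_zero hM, det_laplacian_eq_zero hM (by simpa using h)]
      simp
    | cons a c =>
      have hrec : ∀ p ∈ M, p.1 = a → _ := fun p hpM hpa =>
        ih (M.erase p) (sortedList p.2 ++ c) (by
          intro j
          have hj := h j
          obtain ⟨M, rfl⟩ := Multiset.exists_cons_of_mem hpM
          simp only [typeCount_cons, childCount_cons, Finset.sum_add_distrib,
            Finset.sum_ite_eq, Finset.mem_univ, if_true, List.count_cons, hpa,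
            beq_iff_eq] at hj
          rw [Multiset.erase_cons_head, List.count_append, count_sortedList]
          omega) (by rw [Multiset.card_erase_of_mem hpM, hm]; rfl)
      obtain ⟨hfin, hcard⟩ := finite_and_ncard_withRootsAndVertices_cons a c M
        fun p hpM hpa => (hrec p hpM hpa).1
      refine ⟨hfin, ?_⟩
      have ha : 1 ≤ typeCount M a := by
        have := h a
        rw [List.count_cons_self] at this
        omega
      -- Each term of the recursion is replaced by its value.
      have hstep : ((withRootsAndVertices (a :: c) M).ncard : ℤ) * multiplicityFactorial M =
          ((M.filter (·.1 = a)).map fun p =>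
            (∏ j, ((typeCount (M.erase p) j - 1).factorial : ℤ)) *
              (laplacian (M.erase p)).det).sum := by
        rw [hcard, ← sum_toFinset_filter_mul, Nat.cast_sum, Finset.sum_mul]
        refine Finset.sum_congr rfl fun p hp => ?_
        obtain ⟨hpM, hpa⟩ : p ∈ M ∧ p.1 = a := by simpa using hp
        rw [← (hrec p hpM hpa).2]
        obtain ⟨M, rfl⟩ := Multiset.exists_cons_of_mem hpM
        rw [multiplicityFactorial_cons, Multiset.erase_cons_head]
        push_cast
        ring
      have herase : ∀ p ∈ M.filter (·.1 = a), ∀ j,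
          typeCount (M.erase p) j = typeCount M j - if a = j then 1 else 0 := by
        intro p hp j
        obtain ⟨hpM, rfl⟩ := Multiset.mem_filter.1 hp
        obtain ⟨M, rfl⟩ := Multiset.exists_cons_of_mem hpM
        rw [Multiset.erase_cons_head, typeCount_cons, Nat.add_sub_cancel]
      rw [hstep]
      obtain ha2 | ha1 := Nat.lt_or_eq_of_le ha
      · have hprod : ∀ p ∈ M.filter (·.1 = a),
            (∏ j, ((typeCount (M.erase p) j - 1).factorial : ℤ)) *
              (laplacian (M.erase p)).det =
            (((typeCount M a - 2).factorial : ℤ) *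
              ∏ j ∈ Finset.univ.erase a, ((typeCount M j - 1).factorial : ℤ)) *
              (laplacian (M.erase p)).det := by
          intro p hp
          rw [← Finset.mul_prod_erase _ _ (Finset.mem_univ a), herase p hp a, if_pos rfl,
            Nat.sub_sub]
          congr 2
          refine Finset.prod_congr rfl fun j hj => ?_
          rw [herase p hp j, if_neg (Finset.ne_of_mem_erase hj).symm, Nat.sub_zero]
        rw [Multiset.map_congr rfl hprod, Multiset.sum_map_mul_left,
          sum_det_laplacian_erase ha2, ← Finset.mul_prod_erase _ _ (Finset.mem_univ a),
          show typeCount M a - 1 = (typeCount M a - 2) + 1 by omega, Nat.factorial_succ]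
        push_cast
        ring
      · obtain ⟨p, hp⟩ : ∃ p, M.filter (·.1 = a) = {p} := by
          rw [← Multiset.card_eq_one, ← Multiset.countP_eq_card_filter, ← typeCount, ← ha1]
        have hpf : p ∈ M.filter (·.1 = a) := by simp [hp]
        rw [hp, Multiset.map_singleton, Multiset.sum_singleton]
        have hcol : ∀ i, childCount M i a = 0 := by
          have := h a
          rw [List.count_cons_self, ← ha1] at this
          have h0 : ∑ i, childCount M i a = 0 := by omega
          simpa using h0
        congr 1
        · refine Finset.prod_congr rfl fun j _ => ?_
          rw [herase p hpf j]
          split_ifs with hj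
          · rw [← hj, ← ha1]
          · rfl
        · have h0 := herase p hpf a
          obtain ⟨hpM, rfl⟩ := Multiset.mem_filter.1 hpf
          obtain ⟨M, rfl⟩ := Multiset.exists_cons_of_mem hpM
          rw [if_pos rfl, ← ha1] at h0
          rw [Multiset.erase_cons_head] at h0 ⊢
          exact det_laplacian_of_cons h0 hcol

end PlaneForest

/-! ### Translation of the prescribed data -/

namespace PlaneForest

variable {d : ℕ}

lemma childCount_add (M M' : Multiset (Fin d × (Fin d → ℕ))) (i j : Fin d) :
    childCount (M + M') i j = childCount M i j + childCount M' i j := by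
  simp [childCount]

lemma count_map_fst_vertices (f : PlaneForest d) (i : Fin d) :
    (f.vertices.map Prod.fst).count i = typeCount f.vertices i := by
  rw [typeCount, Multiset.coe_countP, List.count, List.countP_map]
  congr 1

/-- Both sides count the same entries, with different equality tests on `Fin d × (Fin d → ℕ)`. -/
lemma count_vertices (f : PlaneForest d) (p : Fin d × (Fin d → ℕ)) :
    f.vertices.count p = (f.vertices : Multiset _).count p := by
  rw [Multiset.coe_count]
  exact List.countP_congr fun q _ => by simp only [beq_iff_eq]

lemma count_edges (f : PlaneForest d) (i j : Fin d) :
    f.edges.count (i, j) = childCount f.vertices i j := by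
  induction f with
  | nil => simp [edges, vertices, childCount]
  | cons a ch rest ih₁ ih₂ =>
    have hmap : (ch.roots.map fun b => (a, b)).count (i, j) =
        if a = i then ch.roots.count j else 0 := by
      split_ifs with h
      · subst h
        exact List.count_map_of_injective _ _ (Prod.mk_right_injective a) j
      · refine List.count_eq_zero.2 fun hmem => ?_
        obtain ⟨b, -, hb⟩ := List.mem_map.1 hmem
        exact h (Prod.mk.inj hb).1
    rw [edges, vertices, ← Multiset.cons_coe, childCount_cons, ← Multiset.coe_add,
      childCount_add, List.count_append, List.count_append, ih₁, ih₂, hmap, add_comm]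

/-- The multiset with `N i u` copies of `(i, u)` for all `i` and all `u ≤ n`. -/
def boxMultiset (n : Fin d → ℕ) (N : Fin d → (Fin d → ℕ) → ℕ) :
    Multiset (Fin d × (Fin d → ℕ)) :=
  ∑ i, ∑ u ∈ Finset.Iic n, Multiset.replicate (N i u) (i, u)

lemma count_boxMultiset (n : Fin d → ℕ) (N : Fin d → (Fin d → ℕ) → ℕ) (i : Fin d)
    (u : Fin d → ℕ) :
    (boxMultiset n N).count (i, u) = if u ∈ Finset.Iic n then N i u else 0 := by
  simp only [boxMultiset, Multiset.count_sum', Multiset.count_replicate, Prod.mk.injEq]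
  rw [Finset.sum_eq_single i (fun b _ hb => by simp [hb]) (by simp)]
  simp only [true_and]
  exact Finset.sum_ite_eq' (Finset.Iic n) u (N i)

lemma filter_boxMultiset (n : Fin d → ℕ) (N : Fin d → (Fin d → ℕ) → ℕ) (i : Fin d) :
    (boxMultiset n N).filter (·.1 = i) =
      ∑ u ∈ Finset.Iic n, Multiset.replicate (N i u) (i, u) := by
  ext ⟨i', u⟩
  rw [Multiset.count_filter, count_boxMultiset, Multiset.count_sum']
  simp only [Multiset.count_replicate, Prod.mk.injEq]
  by_cases h : i' = i
  · subst h
    simp only [true_and, if_true]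
    exact (Finset.sum_ite_eq' (Finset.Iic n) u (N i')).symm
  · simp [h, Ne.symm h]

lemma typeCount_boxMultiset (n : Fin d → ℕ) (N : Fin d → (Fin d → ℕ) → ℕ) (i : Fin d) :
    typeCount (boxMultiset n N) i = ∑ u ∈ Finset.Iic n, N i u := by
  rw [typeCount, Multiset.countP_eq_card_filter, filter_boxMultiset, Multiset.card_sum]
  simp

lemma childCount_boxMultiset (n : Fin d → ℕ) (N : Fin d → (Fin d → ℕ) → ℕ) (i j : Fin d) :
    childCount (boxMultiset n N) i j = ∑ u ∈ Finset.Iic n, u j * N i u := by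
  rw [childCount, filter_boxMultiset]
  have := map_sum (Multiset.sumAddMonoidHom.comp
    (Multiset.mapAddMonoidHom fun p : Fin d × (Fin d → ℕ) => p.2 j))
    (fun u => Multiset.replicate (N i u) (i, u)) (Finset.Iic n)
  refine this.trans (Finset.sum_congr rfl fun u _ => ?_)
  simp [mul_comm]

lemma multiplicityFactorial_boxMultiset (n : Fin d → ℕ) (N : Fin d → (Fin d → ℕ) → ℕ) :
    multiplicityFactorial (boxMultiset n N) =
      ∏ i, ∏ u ∈ Finset.Iic n, (N i u).factorial := by
  rw [← Finset.prod_product', multiplicityFactorial]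
  refine (Finset.prod_subset ?_ ?_).trans (Finset.prod_congr rfl ?_)
  · rintro ⟨i, u⟩ h
    have h := Multiset.count_ne_zero.2 (Multiset.mem_toFinset.1 h)
    rw [count_boxMultiset] at h
    rw [Finset.mem_product]
    exact ⟨Finset.mem_univ i, by_contra fun hu => h (if_neg hu)⟩
  · intro p _ hp
    rw [Multiset.count_eq_zero_of_notMem (by simpa using hp), Nat.factorial_zero]
  · rintro ⟨i, u⟩ h
    rw [count_boxMultiset, if_pos (Finset.mem_product.1 h).2]

lemma card_eq_sum_typeCount (M : Multiset (Fin d × (Fin d → ℕ))) :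
    M.card = ∑ i, typeCount M i := by
  induction M using Multiset.induction_on with
  | empty => simp [typeCount]
  | cons p M ih => simp [typeCount_cons, Finset.sum_add_distrib, ih]

/-- A multiset of vertices with `n i` vertices of type `i` that has the prescribed multiplicities
inside the box has no room for elements outside the box. -/
lemma eq_boxMultiset_of_count {n : Fin d → ℕ} {N : Fin d → (Fin d → ℕ) → ℕ}
    (hNn : ∀ i, n i = ∑ u ∈ Finset.Iic n, N i u) {V : Multiset (Fin d × (Fin d → ℕ))}
    (hV : ∀ i, typeCount V i = n i) (hN : ∀ i, ∀ u ∈ Finset.Iic n, V.count (i, u) = N i u) :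
    V = boxMultiset n N := by
  refine (Multiset.eq_of_le_of_card_le (Multiset.le_iff_count.2 ?_) ?_).symm
  · rintro ⟨i, u⟩
    rw [count_boxMultiset]
    split_ifs with hu
    · exact (hN i u hu).ge
    · exact Nat.zero_le _
  · rw [card_eq_sum_typeCount, card_eq_sum_typeCount]
    exact (Finset.sum_congr rfl fun i _ => by rw [hV, typeCount_boxMultiset, ← hNn]).le

lemma setOf_forestsWithIndegrees_eq {r n : Fin d → ℕ} {k : Matrix (Fin d) (Fin d) ℤ}
    {N : Fin d → (Fin d → ℕ) → ℕ} (hNn : ∀ i, n i = ∑ u ∈ Finset.Iic n, N i u)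
    (hNk : ∀ i j, kPrime n k i j = ((∑ u ∈ Finset.Iic n, u j * N i u : ℕ) : ℤ))
    {c : List (Fin d)} (hc : ∀ i, c.count i = r i) :
    {f ∈ forestsWithIndegrees r n k N | f.roots = c} =
      withRootsAndVertices c (boxMultiset n N) := by
  ext f
  constructor
  · rintro ⟨⟨⟨hs, hn, -, -⟩, hN⟩, hr⟩
    refine ⟨hs, hr, eq_boxMultiset_of_count hNn (fun i => ?_) fun i u hu => ?_⟩
    · rw [← count_map_fst_vertices, hn]
    · rw [← count_vertices, hN i u hu]
  · rintro ⟨hs, hr, hv⟩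
    refine ⟨⟨⟨hs, fun i => ?_, fun i => by rw [hr, hc], fun i j hij => ?_⟩, fun i u hu => ?_⟩, hr⟩
    · rw [count_map_fst_vertices, hv, typeCount_boxMultiset, ← hNn]
    · rw [count_edges, hv, childCount_boxMultiset, ← hNk, kPrime, if_neg hij]
    · rw [count_vertices, hv, count_boxMultiset, if_pos hu]

end PlaneForest

open PlaneForest in
theorem mainTheorem11 (d : ℕ) (hd : 2 ≤ d)
    (r n : Fin d → ℕ) (k : Matrix (Fin d) (Fin d) ℤ)
    (N : Fin d → (Fin d → ℕ) → ℕ)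
    (hr : 1 ≤ ∑ i, r i)
    (hk : ∀ i j, i ≠ j → 0 ≤ k i j)
    (hkr : ∀ j, -k j j = (r j : ℤ) + ∑ i ∈ Finset.univ.erase j, k i j)
    (hkn : ∀ i, -k i i ≤ (n i : ℤ))
    (hkpos : ∀ i, 0 < -k i i)
    (hNn : ∀ i, n i = ∑ u ∈ Finset.Iic n, N i u)
    (hNk : ∀ i j, kPrime n k i j = ((∑ u ∈ Finset.Iic n, u j * N i u : ℕ) : ℤ))
    (c : List (Fin d)) (hc : ∀ i, c.count i = r i) :
    {f ∈ forestsWithIndegrees r n k N | f.roots = c}.Finite ∧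
      (({f ∈ forestsWithIndegrees r n k N | f.roots = c}.ncard : ℕ) : ℚ) =
        (∏ j, ((n j - 1).factorial : ℚ)) * ((-k).det : ℚ) /
          ∏ i, ∏ u ∈ Finset.Iic n, ((N i u).factorial : ℚ) := by
  have hpos : ∀ i, 1 ≤ n i := fun i => by have := hkpos i; have := hkn i; omega
  have hchild : ∀ i j, (childCount (boxMultiset n N) i j : ℤ) = kPrime n k i j := fun i j => by
    rw [hNk, childCount_boxMultiset]
  have htype : ∀ i, typeCount (boxMultiset n N) i = n i := fun i => by
    rw [typeCount_boxMultiset, ← hNn]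
  have hL : laplacian (boxMultiset n N) = -k := by
    ext i j
    rw [laplacian_apply, hchild, htype, max_eq_left (hpos i), Matrix.neg_apply, kPrime]
    split_ifs with hij
    · subst hij
      ring
    · ring
  have hcount : ∀ j, c.count j + ∑ i, childCount (boxMultiset n N) i j =
      typeCount (boxMultiset n N) j := by
    intro j
    have h₁ : ∑ i ∈ Finset.univ.erase j, kPrime n k i j = ∑ i ∈ Finset.univ.erase j, k i j :=
      Finset.sum_congr rfl fun i hi => if_neg (Finset.ne_of_mem_erase hi)
    have h₂ : kPrime n k j j = n j + k j j := if_pos rfl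
    have h₃ := hkr j
    zify
    rw [hc, htype, Finset.sum_congr rfl fun i _ => hchild i j,
      ← Finset.add_sum_erase _ _ (Finset.mem_univ j), h₁, h₂]
    linarith
  rw [setOf_forestsWithIndegrees_eq hNn hNk hc]
  obtain ⟨hfin, hcard⟩ := finite_and_ncard_withRootsAndVertices _ c hcount
  refine ⟨hfin, ?_⟩
  rw [hL, multiplicityFactorial_boxMultiset] at hcard
  simp only [htype] at hcard
  have h0 : (∏ i, ∏ u ∈ Finset.Iic n, ((N i u).factorial : ℚ)) ≠ 0 :=
    Finset.prod_ne_zero_iff.2 fun i _ => Finset.prod_ne_zero_iff.2 fun u _ =>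
      Nat.cast_ne_zero.2 (Nat.factorial_ne_zero _)
  rw [eq_div_iff h0]
  exact_mod_cast hcard
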